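/- Let $d\ge 2$ and let $X_1,X_2,\dots$ be independent copies of a random vector $X$ in $\mathbb{R}^d$ whose components are independent and have continuous distribution functions $F_1,\dots,F_d$. Call $X_n$ a complete record if each component of $X_n$ is strictly larger than the same component of every $X_m$ with $1\le m<n$ (so $X_1$ is a complete record), and let $T=\sup\{m\ge 1: X_m\text{ is a complete record}\}$. Then $T<\infty$ almost surely, and for every $x\in\mathbb{R}^d$, with $u_i=F_i(x_i)$ and $K'=\{k\}\cup K$, \[ P(X_T\le x)=\sum_{k=1}^{\infty}\left(\frac{\prod_{i=1}^d u_i^{k}}{k^d}-\sum_{K}(-1)^{|K|-1}\prod_{i=1}^d\ \sum_{r\in K'}\frac{u_i^{r}}{r\prod_{s\in K',\,s\ne r}(s-r)}\right), \] where $X_T\le x$ is meant componentwise, and the inner sum is over all nonempty finite subsets $K$ of $\{k+1,k+2,\dots\}$. For each $k$ the sum over $K$ converges absolutely, and the series over $k$ converges. -/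

import Mathlib

open MeasureTheory ProbabilityTheory

/-- The `n`-th term of a sequence `y 1, y 2, …` of vectors in `ℝ^d` is a complete record if each of
its components is strictly larger than the same component of every earlier term. In particular the
first term always is one. -/
def IsCompleteRecord {d : ℕ} (y : ℕ+ → Fin d → ℝ) (n : ℕ+) : Prop :=
  ∀ m < n, ∀ i, y m i < y n i

/-- `T = sup {m : y m is a complete record}`, the index of the terminal complete record; its value
is `⊤` if there are infinitely many complete records. -/
noncomputable def terminalTime {d : ℕ} (y : ℕ+ → Fin d → ℝ) : ℕ∞ :=
  sSup ((fun m : ℕ+ => ((m : ℕ) : ℕ∞)) '' {m | IsCompleteRecord y m})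

/-- The event `X_T ≤ x` (componentwise), i.e. `T` is finite and the vector with index `T` lies
below `x`. -/
def terminalRecordLE {Ω : Type*} {d : ℕ} (X : ℕ+ → Ω → Fin d → ℝ) (x : Fin d → ℝ) : Set Ω :=
  {ω | ∃ n : ℕ+, terminalTime (fun m => X m ω) = ((n : ℕ) : ℕ∞) ∧ ∀ i, X n ω i ≤ x i}

/-- The nonempty finite subsets `K` of `{k + 1, k + 2, …}`. -/
abbrev LaterIndices (k : ℕ) : Type :=
  {K : Finset ℕ // K.Nonempty ∧ ∀ j ∈ K, k < j}

/-- `∑_{r ∈ S} u ^ r / (r ∏_{s ∈ S, s ≠ r} (s - r))`. -/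
noncomputable def recordFactor (S : Finset ℕ) (u : ℝ) : ℝ :=
  ∑ r ∈ S, u ^ r / ((r : ℝ) * ∏ s ∈ S.erase r, ((s : ℝ) - (r : ℝ)))

/-- The term `(-1) ^ (|K| - 1) ∏_i (…)` of the inclusion–exclusion sum, with `K' = {k} ∪ K`. -/
noncomputable def inclExclTerm {d : ℕ} (u : Fin d → ℝ) (k : ℕ) (K : LaterIndices k) : ℝ :=
  (-1 : ℝ) ^ (K.1.card - 1) * ∏ i, recordFactor (insert k K.1) (u i)

/-! The event that T = k is a complete record at k followed by no later one. These events are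
disjoint, so P(X_T ≤ x) is the sum over k of the probability that k is a complete record with X_k ≤
x, minus the part on which a later complete record occurs. That part is a union over j > k, which
inclusion–exclusion turns into a sum over K. Each intersection is a condition on every component
separately, so its probability factors over i.

For one component, let p(k, S) be the probability of records at k and at all of S, with the k-th
term in B. Let k < l, with l below all of T. On the event of p(k, T), the maximum of the first l
terms sits at k or at one of the l - k places after k. Exchanging that place with l gives p(k, T) =
p(l, T) + (l - k) p(k, {l} ∪ T) (`sub_mul_measureReal_recordEvent`). This is the recursion of
divided differences, so p(k, S) is the divided sum of c(r) = p(r, ∅) over {k} ∪ S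
(`measureReal_recordEvent`). For B = (-∞, x], c(r) = u^r / r, which gives the stated factor. For B
the whole line, c(r) = 1 / r, and the divided sum collapses to ∏ 1 / s.

Hence a set K' of complete records has probability ∏ s^(-d). As d ≥ 2, ∑ s^(-d) converges:
Borel–Cantelli gives T < ∞, and the sum over K converges absolutely. -/

/-! ### Independence, reindexing and ties -/

/-- If the random variables `Y i j`, indexed by all pairs, are independent, then so are the
families `Y i`. -/
theorem iIndepFun_curry {Ω ι κ : Type*} [MeasurableSpace Ω] {P : Measure Ω} {E : Type*}
    [MeasurableSpace E] {Y : ι → κ → Ω → E} (hY : ∀ i j, Measurable (Y i j))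
    (h : iIndepFun (fun (p : (_ : ι) × κ) ω => Y p.1 p.2 ω) P) :
    iIndepFun (fun i ω j => Y i j ω) P := by
  have := h.isProbabilityMeasure
  have : ∀ i j, IsProbabilityMeasure (P.map (Y i j)) :=
    fun i j => Measure.isProbabilityMeasure_map (hY i j).aemeasurable
  have hcurry : (MeasurableEquiv.piCurry (fun (_ : ι) (_ : κ) => E)) ∘
      (fun ω (p : (_ : ι) × κ) => Y p.1 p.2 ω) = fun ω i j => Y i j ω := by
    ext; simp [Sigma.curry]
  have hrow : ∀ i, iIndepFun (Y i) P := fun i =>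
    h.precomp (g := fun j : κ => (⟨i, j⟩ : (_ : ι) × κ)) (fun a b hab => by simpa using hab)
  rw [iIndepFun_iff_map_fun_eq_infinitePi_map (by fun_prop), ← hcurry,
    ← Measure.map_map (by fun_prop) (by fun_prop),
    h.map_fun_eq_infinitePi_map (by fun_prop),
    Measure.infinitePi_map_piCurry (fun i j => P.map (Y i j))]
  congrm Measure.infinitePi fun i => ?_
  rw [(hrow i).map_fun_eq_infinitePi_map (hY i)]

/-- For independent random vectors with independent components, the sequences of components are
independent. -/
theorem iIndepFun_components {Ω ι κ : Type*} [MeasurableSpace Ω] {P : Measure Ω} {E : Type*}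
    [MeasurableSpace E] {X : κ → Ω → ι → E} (hX : ∀ n, Measurable (X n))
    (h : iIndepFun X P) (hcomp : ∀ n, iIndepFun (fun i ω => X n ω i) P) :
    iIndepFun (fun i ω n => X n ω i) P ∧ ∀ i, iIndepFun (fun n ω => X n ω i) P := by
  have hm : ∀ n i, Measurable (fun ω => X n ω i) := fun n i => by fun_prop
  have hall : iIndepFun (fun (p : κ × ι) ω => X p.1 ω p.2) P :=
    iIndepFun_uncurry' (X := fun n i ω => X n ω i) hm h hcomp
  refine ⟨iIndepFun_curry (Y := fun i n ω => X n ω i) (fun i n => hm n i) ?_, fun i => ?_⟩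
  · refine hall.precomp (g := fun p : (_ : ι) × κ => (p.2, p.1)) ?_
    rintro ⟨a, b⟩ ⟨c, d⟩ hab
    simp only [Prod.mk.injEq] at hab
    simp [hab.1, hab.2]
  · exact hall.precomp (g := fun n => (n, i)) (fun a b hab => by simpa using hab)

/-- The law of an independent identically distributed sequence is invariant under reindexing. -/
theorem map_comp_injective_of_iIndepFun {Ω κ : Type*} [MeasurableSpace Ω] {P : Measure Ω}
    {E : Type*} [MeasurableSpace E] {Y : κ → Ω → E} (hY : ∀ n, Measurable (Y n))
    (h : iIndepFun Y P) {μ : Measure E} (hid : ∀ n, P.map (Y n) = μ)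
    {g : κ → κ} (hg : g.Injective) :
    (P.map (fun ω n => Y n ω)).map (fun y n => y (g n)) = P.map (fun ω n => Y n ω) := by
  rw [Measure.map_map (by fun_prop) (by fun_prop)]
  change P.map (fun ω n => Y (g n) ω) = _
  rw [(h.precomp hg).map_fun_eq_infinitePi_map (fun n => hY (g n)),
    h.map_fun_eq_infinitePi_map hY]
  simp [hid]

/-- Two independent random variables, one of which has an atomless law, are almost surely
different. -/
theorem measure_eq_zero_of_indepFun {Ω E : Type*} [MeasurableSpace Ω] {P : Measure Ω}
    [IsProbabilityMeasure P] [MeasurableSpace E] [MeasurableEq E] {Y Z : Ω → E}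
    (hY : Measurable Y) (hZ : Measurable Z) (h : IndepFun Y Z P) [NullSingletonClass (P.map Z)] :
    P {ω | Y ω = Z ω} = 0 := by
  have := Measure.isProbabilityMeasure_map (μ := P) hY.aemeasurable
  have := Measure.isProbabilityMeasure_map (μ := P) hZ.aemeasurable
  have hd : MeasurableSet {p : E × E | p.1 = p.2} :=
    measurableSet_eq_fun measurable_fst measurable_snd
  have hs : {ω | Y ω = Z ω} = (fun ω => (Y ω, Z ω)) ⁻¹' {p : E × E | p.1 = p.2} := rfl
  -- Fubini: the sections of the diagonal are points, which are null for the law of Z.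
  rw [hs, ← Measure.map_apply (by fun_prop) hd,
    (indepFun_iff_map_prod_eq_prod_map_map hY.aemeasurable hZ.aemeasurable).1 h,
    Measure.measure_prod_null hd]
  refine Filter.Eventually.of_forall fun a => ?_
  have : Prod.mk a ⁻¹' {p : E × E | p.1 = p.2} = {a} := by
    ext b; simp [eq_comm]
  simp only [this, measure_singleton, Pi.zero_apply]

/-- A probability measure on `ℝ` with continuous distribution function has no atoms. -/
theorem nullSingletonClass_of_continuous_cdf {μ : Measure ℝ} [IsProbabilityMeasure μ]
    (h : Continuous (cdf μ)) : NullSingletonClass μ := by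
  refine ⟨fun x => ?_⟩
  rw [← measure_cdf μ, StieltjesFunction.measure_singleton,
    h.continuousAt.continuousWithinAt.leftLim_eq]
  simp

/-! ### Divided sums -/

/-- `∑_{r ∈ S} c r / ∏_{s ∈ S, s ≠ r} (s - r)`, up to sign the divided difference of `c` at `S`. -/
noncomputable def dividedSum (c : ℕ → ℝ) (S : Finset ℕ) : ℝ :=
  ∑ r ∈ S, c r / ∏ s ∈ S.erase r, ((s : ℝ) - r)

theorem dividedSum_singleton (c : ℕ → ℝ) (k : ℕ) : dividedSum c {k} = c k := by
  simp [dividedSum]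

/-- The divided-difference recursion. For r in T it comes from (b - a) / ((a - r)(b - r)) = 1 / (a -
r) - 1 / (b - r). -/
theorem dividedSum_insert_insert (c : ℕ → ℝ) {a b : ℕ} {T : Finset ℕ} (hab : a ≠ b) (ha : a ∉ T)
    (hb : b ∉ T) :
    ((b : ℝ) - a) * dividedSum c (insert a (insert b T)) =
      dividedSum c (insert a T) - dividedSum c (insert b T) := by
  have hne : ∀ {x y : ℕ}, x ≠ y → (x : ℝ) - y ≠ 0 := fun h =>
    sub_ne_zero.2 (Nat.cast_injective.ne h)
  have ha' : a ∉ insert b T := by simp [hab, ha]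
  unfold dividedSum
  rw [Finset.sum_insert ha', Finset.sum_insert hb, Finset.sum_insert ha, Finset.sum_insert hb,
    Finset.erase_insert ha', Finset.erase_insert ha, Finset.erase_insert hb,
    Finset.erase_insert_of_ne hab, Finset.erase_insert hb, Finset.prod_insert hb,
    Finset.prod_insert ha]
  have hsum : ∀ r ∈ T, ((b : ℝ) - a) *
      (c r / ∏ s ∈ (insert a (insert b T)).erase r, ((s : ℝ) - r)) =
      c r / ∏ s ∈ (insert a T).erase r, ((s : ℝ) - r) -
        c r / ∏ s ∈ (insert b T).erase r, ((s : ℝ) - r) := by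
    intro r hr
    have har : a ≠ r := fun h => ha (h ▸ hr)
    have hbr : b ≠ r := fun h => hb (h ▸ hr)
    rw [Finset.erase_insert_of_ne har, Finset.erase_insert_of_ne hbr,
      Finset.erase_insert_of_ne har, Finset.prod_insert (by simp [hab, ha]),
      Finset.prod_insert (by simp [hb]),
      Finset.prod_insert (by simp [ha])]
    have hP : ∏ s ∈ T.erase r, ((s : ℝ) - r) ≠ 0 :=
      Finset.prod_ne_zero_iff.2 fun s hs => hne (Finset.ne_of_mem_erase hs)
    have := hne har
    have := hne hbr
    field_simp
    ring
  rw [mul_add, mul_add, Finset.mul_sum, Finset.sum_congr rfl hsum, Finset.sum_sub_distrib]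
  have hPa : ∏ s ∈ T, ((s : ℝ) - a) ≠ 0 :=
    Finset.prod_ne_zero_iff.2 fun s hs => hne fun h => ha (h ▸ hs)
  have hPb : ∏ s ∈ T, ((s : ℝ) - b) ≠ 0 :=
    Finset.prod_ne_zero_iff.2 fun s hs => hne fun h => hb (h ▸ hs)
  have h1 : ((b : ℝ) - a) * (c a / (((b : ℝ) - a) * ∏ s ∈ T, ((s : ℝ) - a))) =
      c a / ∏ s ∈ T, ((s : ℝ) - a) := by
    have := hne hab.symm
    field_simp
  have h2 : ((b : ℝ) - a) * (c b / (((a : ℝ) - b) * ∏ s ∈ T, ((s : ℝ) - b))) =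
      -(c b / ∏ s ∈ T, ((s : ℝ) - b)) := by
    have := hne hab
    field_simp
    ring
  rw [h1, h2]
  ring

/-- Products of reciprocals satisfy the same recursion, because 1/a - 1/b = (b - a)/(ab). This is
what makes the records of one component independent. -/
theorem dividedSum_inv {S : Finset ℕ} (hS : S.Nonempty) (h0 : 0 ∉ S) :
    dividedSum (fun r => (r : ℝ)⁻¹) S = ∏ s ∈ S, (s : ℝ)⁻¹ := by
  induction hn : S.card using Nat.strong_induction_on generalizing S with
  | _ n ih =>
    obtain ⟨a, ha⟩ := hS
    obtain rfl | hab := eq_or_ne S {a}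
    · simp [dividedSum_singleton]
    obtain ⟨b, hb, hne⟩ : ∃ b ∈ S, b ≠ a := by
      by_contra! hall
      exact hab (Finset.eq_singleton_iff_unique_mem.2 ⟨ha, hall⟩)
    set T := (S.erase a).erase b with hT
    have hbS : b ∈ S.erase a := Finset.mem_erase.2 ⟨hne, hb⟩
    have hST : S = insert a (insert b T) := by
      rw [hT, Finset.insert_erase hbS, Finset.insert_erase ha]
    have haT : a ∉ T := by simp [hT]
    have hbT : b ∉ T := by simp [hT]
    have hcard : S.card = T.card + 2 := by
      rw [hST, Finset.card_insert_of_notMem (by simp [hne.symm, haT]),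
        Finset.card_insert_of_notMem hbT]
    have hT0 : 0 ∉ T := fun h => h0 (Finset.mem_of_mem_erase (Finset.mem_of_mem_erase h))
    have ha0 : a ≠ 0 := fun h => h0 (h ▸ ha)
    have hb0 : b ≠ 0 := fun h => h0 (h ▸ hb)
    have hsub : (b : ℝ) - a ≠ 0 := sub_ne_zero.2 (Nat.cast_injective.ne hne)
    refine mul_left_cancel₀ hsub ?_
    rw [hST, dividedSum_insert_insert _ hne.symm haT hbT,
      ih (insert a T).card (by rw [Finset.card_insert_of_notMem haT]; omega)
        (Finset.insert_nonempty _ _) (by simp [hT0, ha0.symm]) rfl,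
      ih (insert b T).card (by rw [Finset.card_insert_of_notMem hbT]; omega)
        (Finset.insert_nonempty _ _) (by simp [hT0, hb0.symm]) rfl,
      Finset.prod_insert haT, Finset.prod_insert hbT,
      Finset.prod_insert (by simp [hne.symm, haT] : a ∉ insert b T), Finset.prod_insert hbT]
    have ha' : (a : ℝ) ≠ 0 := Nat.cast_ne_zero.2 ha0
    have hb' : (b : ℝ) ≠ 0 := Nat.cast_ne_zero.2 hb0
    field_simp

theorem recordFactor_eq_dividedSum (S : Finset ℕ) (u : ℝ) :
    recordFactor S u = dividedSum (fun r => u ^ r / r) S := by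
  unfold recordFactor dividedSum
  exact Finset.sum_congr rfl fun r _ => by rw [div_div]

/-! ### Records of a real sequence under transpositions -/

/-- The `n`-th term of a real sequence is strictly larger than all earlier terms. -/
def IsStrictRecord (y : ℕ+ → ℝ) (n : ℕ+) : Prop :=
  ∀ m < n, y m < y n

/-- The sequences with records at `k` and at all indices in `S`, and with `k`-th term in `B`. -/
def recordEvent (k : ℕ+) (S : Finset ℕ) (B : Set ℝ) : Set (ℕ+ → ℝ) :=
  {y | IsStrictRecord y k ∧ y k ∈ B ∧ ∀ n : ℕ+, (n : ℕ) ∈ S → IsStrictRecord y n}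

/-- The sequences whose first `k` terms have their strict maximum at index `j`. -/
def strictMaxEvent (k j : ℕ+) : Set (ℕ+ → ℝ) :=
  {y | ∀ m ≤ k, m ≠ j → y m < y j}

theorem measurableSet_isStrictRecord (n : ℕ+) : MeasurableSet {y | IsStrictRecord y n} := by
  simp only [IsStrictRecord, Set.ofPred_forall]
  exact .iInter fun m => .iInter fun _ =>
    measurableSet_lt (measurable_pi_apply m) (measurable_pi_apply n)

theorem measurableSet_recordEvent (k : ℕ+) (S : Finset ℕ) {B : Set ℝ} (hB : MeasurableSet B) :
    MeasurableSet (recordEvent k S B) := by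
  refine (measurableSet_isStrictRecord k).inter ((measurable_pi_apply k hB).inter ?_)
  have : {y : ℕ+ → ℝ | ∀ n : ℕ+, (n : ℕ) ∈ S → IsStrictRecord y n} =
      ⋂ (n : ℕ+) (_ : (n : ℕ) ∈ S), {y | IsStrictRecord y n} := by ext; simp
  change MeasurableSet {y : ℕ+ → ℝ | ∀ n : ℕ+, (n : ℕ) ∈ S → IsStrictRecord y n}
  rw [this]
  exact .iInter fun n => .iInter fun _ => measurableSet_isStrictRecord n

theorem measurableSet_strictMaxEvent (k j : ℕ+) : MeasurableSet (strictMaxEvent k j) := by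
  simp only [strictMaxEvent, Set.ofPred_forall]
  exact .iInter fun m => .iInter fun _ => .iInter fun _ =>
    measurableSet_lt (measurable_pi_apply m) (measurable_pi_apply j)

theorem isStrictRecord_iff_mem_strictMaxEvent {y : ℕ+ → ℝ} {k : ℕ+} :
    IsStrictRecord y k ↔ y ∈ strictMaxEvent k k :=
  ⟨fun h m hm hne => h m (lt_of_le_of_ne hm hne), fun h m hm => h m hm.le hm.ne⟩

theorem swap_le_iff {a b n m : ℕ+} (ha : a ≤ n) (hb : b ≤ n) : Equiv.swap a b m ≤ n ↔ m ≤ n := by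
  rw [Equiv.swap_apply_def]; split_ifs <;> simp_all

theorem swap_lt_iff {a b n m : ℕ+} (ha : a < n) (hb : b < n) : Equiv.swap a b m < n ↔ m < n := by
  rw [Equiv.swap_apply_def]; split_ifs <;> simp_all

theorem swap_mem_strictMaxEvent_iff {a b k : ℕ+} (ha : a ≤ k) (hb : b ≤ k) {y : ℕ+ → ℝ} :
    (fun m => y (Equiv.swap a b m)) ∈ strictMaxEvent k a ↔ y ∈ strictMaxEvent k b := by
  constructor
  · intro h m hm hne
    have := h (Equiv.swap a b m) ((swap_le_iff ha hb).2 hm) (by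
      rwa [Ne, Equiv.swap_apply_eq_iff, Equiv.swap_apply_left])
    simpa using this
  · intro h m hm hne
    have := h (Equiv.swap a b m) ((swap_le_iff ha hb).2 hm) (by
      rwa [Ne, Equiv.swap_apply_eq_iff, Equiv.swap_apply_right])
    simpa using this

theorem isStrictRecord_swap_iff {a b n : ℕ+} (ha : a < n) (hb : b < n) {y : ℕ+ → ℝ} :
    IsStrictRecord (fun m => y (Equiv.swap a b m)) n ↔ IsStrictRecord y n := by
  have hn : Equiv.swap a b n = n := Equiv.swap_apply_of_ne_of_ne ha.ne' hb.ne'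
  simp only [IsStrictRecord, hn]
  constructor
  · intro h m hm
    simpa using h (Equiv.swap a b m) ((swap_lt_iff ha hb).2 hm)
  · intro h m hm
    exact h _ ((swap_lt_iff ha hb).2 hm)

theorem isStrictRecord_swap_iff_of_lt {a b n : ℕ+} (ha : n < a) (hb : n < b) {y : ℕ+ → ℝ} :
    IsStrictRecord (fun m => y (Equiv.swap a b m)) n ↔ IsStrictRecord y n := by
  have hfix : ∀ m ≤ n, Equiv.swap a b m = m := fun m hm =>
    Equiv.swap_apply_of_ne_of_ne (hm.trans_lt ha).ne (hm.trans_lt hb).ne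
  simp only [IsStrictRecord, hfix n le_rfl]
  exact forall₂_congr fun m hm => by rw [hfix m hm.le]

/-! ### Record probabilities for exchangeable sequences -/

/-- A law of real sequences that is invariant under transpositions of the index set and almost
surely has no ties. -/
structure ExchangeableWithoutTies (ν : Measure (ℕ+ → ℝ)) : Prop where
  map_swap : ∀ a b : ℕ+, ν.map (fun y n => y (Equiv.swap a b n)) = ν
  ties_null : ∀ a b : ℕ+, a ≠ b → ν {y | y a = y b} = 0

namespace ExchangeableWithoutTies

variable {ν : Measure (ℕ+ → ℝ)}

theorem measureReal_preimage_swap (h : ExchangeableWithoutTies ν) (a b : ℕ+)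
    {G : Set (ℕ+ → ℝ)} (hG : MeasurableSet G) :
    ν.real {y | (fun n => y (Equiv.swap a b n)) ∈ G} = ν.real G := by
  conv_rhs => rw [← h.map_swap a b, map_measureReal_apply (by fun_prop) hG]
  rfl

/-- Without ties, the first k terms have almost surely exactly one strict maximum; its place
partitions the event. -/
theorem measureReal_eq_sum_strictMax [IsProbabilityMeasure ν] (h : ExchangeableWithoutTies ν)
    {G : Set (ℕ+ → ℝ)} (hG : MeasurableSet G) (k : ℕ+) :
    ν.real G = ∑ j ∈ Finset.Icc 1 k, ν.real (G ∩ strictMaxEvent k j) := by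
  rw [← measureReal_biUnion_finset]
  · have hinj : ∀ᵐ y ∂ν, ∀ a b : ℕ+, a ≠ b → y a ≠ y b := by
      rw [ae_all_iff]; intro a
      rw [ae_all_iff]; intro b
      by_cases hab : a = b
      · simp [hab]
      · filter_upwards [measure_eq_zero_iff_ae_notMem.1 (h.ties_null a b hab)] with y hy _
        exact hy
    refine measureReal_congr ?_
    filter_upwards [hinj] with y hy
    refine propext ⟨fun hyG => ?_, fun hyG => ?_⟩
    · obtain ⟨j, hj, hmax⟩ := Finset.exists_max_image (Finset.Icc 1 k) y ⟨1, by simp⟩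
      refine Set.mem_biUnion hj ⟨hyG, fun m hm hne => ?_⟩
      exact lt_of_le_of_ne (hmax m (by simp [hm])) (hy m j hne)
    · obtain ⟨j, -, hj⟩ := Set.mem_iUnion₂.1 hyG
      exact hj.1
  · intro i hi j hj hij
    refine Set.disjoint_left.2 fun y hyi hyj => ?_
    simp only [Finset.coe_Icc, Set.mem_Icc] at hi hj
    exact lt_asymm (hyi.2 j hj.2 hij.symm) (hyj.2 i hi.2 hij)
  · exact fun j _ => hG.inter (measurableSet_strictMaxEvent k j)

/-- If an event is symmetric in the first `k` terms, then it is equally likely to occur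
together with a maximum of these terms at any of the `k` places. -/
theorem measureReal_eq_mul_recordEvent [IsProbabilityMeasure ν] (h : ExchangeableWithoutTies ν)
    (k : ℕ+) {G : Set (ℕ+ → ℝ)} (hG : MeasurableSet G)
    (hsymm : ∀ j ≤ k, ∀ y, (fun n => y (Equiv.swap j k n)) ∈ G ↔ y ∈ G) :
    ν.real G = k * ν.real (G ∩ {y | IsStrictRecord y k}) := by
  rw [h.measureReal_eq_sum_strictMax hG k, Finset.sum_congr rfl
    (g := fun _ => ν.real (G ∩ {y | IsStrictRecord y k}))]
  · simp [PNat.card_Icc]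
  · intro j hj
    rw [Finset.mem_Icc] at hj
    rw [← h.measureReal_preimage_swap j k (hG.inter (measurableSet_strictMaxEvent k j))]
    congr 1
    ext y
    simp only [Set.mem_ofPred_eq, Set.mem_inter_iff, hsymm j hj.2,
      swap_mem_strictMaxEvent_iff hj.2 le_rfl, isStrictRecord_iff_mem_strictMaxEvent]

/-- Split the event by the place j of the maximum of the first l terms and swap j with l. Records
beyond l do not notice the swap. -/
theorem sub_mul_measureReal_recordEvent [IsProbabilityMeasure ν] (h : ExchangeableWithoutTies ν)
    {k l : ℕ+} (hkl : k < l) {T : Finset ℕ} (hT : ∀ t ∈ T, (l : ℕ) < t) {B : Set ℝ}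
    (hB : MeasurableSet B) :
    ((l : ℝ) - k) * ν.real (recordEvent k (insert (l : ℕ) T) B) =
      ν.real (recordEvent k T B) - ν.real (recordEvent l T B) := by
  have hG := measurableSet_recordEvent k T hB
  have hT' : ∀ n : ℕ+, (n : ℕ) ∈ T → l < n := fun n hn => hT _ hn
  -- A record at k excludes a maximum at j < k.
  have hlow : ∑ j ∈ Finset.Icc 1 l, ν.real (recordEvent k T B ∩ strictMaxEvent l j) =
      ∑ j ∈ Finset.Icc k l, ν.real (recordEvent k T B ∩ strictMaxEvent l j) := by
    symm
    refine Finset.sum_subset (Finset.Icc_subset_Icc_left one_le) fun j hj hj' => ?_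
    have hjk : j < k := by
      by_contra hjk
      exact hj' (Finset.mem_Icc.2 ⟨not_lt.1 hjk, (Finset.mem_Icc.1 hj).2⟩)
    have : recordEvent k T B ∩ strictMaxEvent l j = ∅ := by
      refine Set.eq_empty_of_forall_notMem fun y hy => ?_
      exact lt_asymm (hy.1.1 j hjk) (hy.2 k hkl.le hjk.ne')
    simp [this]
  -- For j = k the swap carries the value in B to place l; the record at k is then implied by the
  -- maximum and drops out.
  have hfirst : ν.real (recordEvent k T B ∩ strictMaxEvent l k) = ν.real (recordEvent l T B) := by
    rw [← h.measureReal_preimage_swap k l (hG.inter (measurableSet_strictMaxEvent l k))]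
    congr 1
    ext y
    have hrec : (∀ n : ℕ+, (n : ℕ) ∈ T → IsStrictRecord (fun m => y (Equiv.swap k l m)) n) ↔
        ∀ n : ℕ+, (n : ℕ) ∈ T → IsStrictRecord y n :=
      forall₂_congr fun n hn => isStrictRecord_swap_iff (hkl.trans (hT' n hn)) (hT' n hn)
    have hmax := swap_mem_strictMaxEvent_iff (y := y) hkl.le le_rfl
    simp only [Set.mem_ofPred_eq, Set.mem_inter_iff, recordEvent, hrec, hmax,
      Equiv.swap_apply_left, isStrictRecord_iff_mem_strictMaxEvent (k := l)]
    refine ⟨fun hy => ⟨hy.2, hy.1.2⟩, fun hy => ⟨⟨fun m hm => ?_, hy.2⟩, hy.1⟩⟩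
    exact (hmax.2 hy.1) m (hm.trans hkl).le hm.ne
  -- For k < j ≤ l the swap leaves the first k terms alone and creates a record at l, so all l - k
  -- places contribute equally.
  have hrest : ∀ j ∈ Finset.Ioc k l, ν.real (recordEvent k T B ∩ strictMaxEvent l j) =
      ν.real (recordEvent k (insert (l : ℕ) T) B) := by
    intro j hj
    rw [Finset.mem_Ioc] at hj
    rw [← h.measureReal_preimage_swap j l (hG.inter (measurableSet_strictMaxEvent l j))]
    congr 1
    ext y
    have hrec : (∀ n : ℕ+, (n : ℕ) ∈ T → IsStrictRecord (fun m => y (Equiv.swap j l m)) n) ↔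
        ∀ n : ℕ+, (n : ℕ) ∈ T → IsStrictRecord y n :=
      forall₂_congr fun n hn =>
        isStrictRecord_swap_iff (hj.2.trans_lt (hT' n hn)) (hT' n hn)
    simp only [Set.mem_ofPred_eq, Set.mem_inter_iff, recordEvent, hrec,
      swap_mem_strictMaxEvent_iff hj.2 le_rfl, isStrictRecord_swap_iff_of_lt hj.1 hkl,
      Equiv.swap_apply_of_ne_of_ne hj.1.ne hkl.ne, Finset.mem_insert, PNat.coe_inj,
      ← isStrictRecord_iff_mem_strictMaxEvent, forall_eq_or_imp]
    tauto
  have hsum := h.measureReal_eq_sum_strictMax hG l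
  rw [hlow, ← Finset.Ioc_insert_left hkl.le, Finset.sum_insert (by simp), hfirst,
    Finset.sum_congr rfl hrest, Finset.sum_const, PNat.card_Ioc, nsmul_eq_mul,
    Nat.cast_sub (show (k : ℕ) ≤ l from hkl.le)] at hsum
  linarith

/-- The probability of prescribed records, in terms of the probabilities of single records. -/
theorem measureReal_recordEvent [IsProbabilityMeasure ν] (h : ExchangeableWithoutTies ν)
    {B : Set ℝ} (hB : MeasurableSet B) {c : ℕ → ℝ}
    (hc : ∀ k : ℕ+, ν.real (recordEvent k ∅ B) = c k) (k : ℕ+) (S : Finset ℕ)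
    (hS : ∀ s ∈ S, (k : ℕ) < s) :
    ν.real (recordEvent k S B) = dividedSum c (insert (k : ℕ) S) := by
  induction hn : S.card generalizing k S with
  | zero =>
    rw [Finset.card_eq_zero] at hn
    subst hn
    rw [hc k]
    exact (dividedSum_singleton c k).symm
  | succ n ih =>
    have hne : S.Nonempty := Finset.card_pos.1 (by omega)
    -- Removing the least element leaves T above both k and l, so the induction hypothesis applies
    -- with either as base.
    obtain ⟨l, hl⟩ : ∃ l : ℕ+, (l : ℕ) = S.min' hne :=
      ⟨⟨S.min' hne, (Nat.zero_le _).trans_lt (hS _ (S.min'_mem hne))⟩, rfl⟩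
    have hlS : (l : ℕ) ∈ S := hl ▸ S.min'_mem hne
    set T := S.erase l with hT
    have hST : S = insert (l : ℕ) T := (Finset.insert_erase hlS).symm
    have hcard : T.card = n := by rw [hT, Finset.card_erase_of_mem hlS, hn]; rfl
    have hlT : ∀ t ∈ T, (l : ℕ) < t := fun t ht =>
      lt_of_le_of_ne (hl ▸ S.min'_le t (Finset.mem_of_mem_erase ht))
        (Finset.ne_of_mem_erase ht).symm
    have hkl : (k : ℕ) < l := hS _ hlS
    have hkT : ∀ t ∈ T, (k : ℕ) < t := fun t ht => hkl.trans (hlT t ht)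
    have h0 : ((l : ℕ) : ℝ) - (k : ℕ) ≠ 0 := sub_ne_zero.2 (by exact_mod_cast hkl.ne')
    refine mul_left_cancel₀ h0 ?_
    rw [hST, h.sub_mul_measureReal_recordEvent hkl hlT hB, ih k T hkT hcard, ih l T hlT hcard,
      dividedSum_insert_insert c hkl.ne (fun hk => (hkT _ hk).ne rfl) (fun hk => (hlT _ hk).ne rfl)]

/-- At a record, a condition on the k-th term can be traded for a condition G symmetric in the first
k terms; symmetry then gives place k the share 1 / k of G. -/
theorem measureReal_recordEvent_empty [IsProbabilityMeasure ν] (h : ExchangeableWithoutTies ν)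
    (B : Set ℝ) (k : ℕ+) {G : Set (ℕ+ → ℝ)} (hG : MeasurableSet G)
    (hsymm : ∀ j ≤ k, ∀ y, (fun n => y (Equiv.swap j k n)) ∈ G ↔ y ∈ G)
    (hGB : ∀ y, IsStrictRecord y k → (y ∈ G ↔ y k ∈ B)) :
    ν.real (recordEvent k ∅ B) = ν.real G / k := by
  rw [h.measureReal_eq_mul_recordEvent k hG hsymm, mul_div_cancel_left₀]
  · congr 1
    ext y
    simp only [recordEvent, Set.mem_ofPred_eq, Finset.notMem_empty, false_imp_iff, implies_true,
      and_true, Set.mem_inter_iff]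
    exact ⟨fun hy => ⟨(hGB y hy.1).2 hy.2, hy.1⟩, fun hy => ⟨hy.2, (hGB y hy.2).1 hy.1⟩⟩
  · exact_mod_cast k.ne_zero

/-- The events of a record at different indices are independent, with probabilities `1 / s`. -/
theorem measureReal_recordEvent_univ [IsProbabilityMeasure ν] (h : ExchangeableWithoutTies ν)
    (k : ℕ+) (S : Finset ℕ) (hS : ∀ s ∈ S, (k : ℕ) < s) :
    ν.real (recordEvent k S Set.univ) = ∏ s ∈ insert (k : ℕ) S, (s : ℝ)⁻¹ := by
  have hc : ∀ k : ℕ+, ν.real (recordEvent k ∅ Set.univ) = ((k : ℕ) : ℝ)⁻¹ := fun k => by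
    rw [h.measureReal_recordEvent_empty _ k MeasurableSet.univ (by simp) (by simp)]
    simp
  rw [h.measureReal_recordEvent .univ (c := fun r => (r : ℝ)⁻¹) hc k S hS]
  refine dividedSum_inv (Finset.insert_nonempty _ _) fun h0 => ?_
  rcases Finset.mem_insert.1 h0 with h0 | h0
  · exact k.ne_zero h0.symm
  · exact absurd (hS 0 h0) (Nat.not_lt_zero _)

/-- Here G says that all of the first k terms are at most x, so c(k) = u^k / k. -/
theorem measureReal_recordEvent_Iic [IsProbabilityMeasure ν] (h : ExchangeableWithoutTies ν)
    {x u : ℝ} (hu : ∀ k : ℕ+, ν.real {y | ∀ m ≤ k, y m ≤ x} = u ^ (k : ℕ))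
    (k : ℕ+) (S : Finset ℕ) (hS : ∀ s ∈ S, (k : ℕ) < s) :
    ν.real (recordEvent k S (Set.Iic x)) = recordFactor (insert (k : ℕ) S) u := by
  rw [recordFactor_eq_dividedSum]
  refine h.measureReal_recordEvent measurableSet_Iic (fun k => ?_) k S hS
  rw [← hu k]
  refine h.measureReal_recordEvent_empty _ k ?_ (fun j hj y => ?_) fun y hy => ?_
  · simp only [Set.ofPred_forall]
    exact .iInter fun m => .iInter fun _ => measurable_pi_apply m measurableSet_Iic
  · simp only [Set.mem_ofPred_eq]
    constructor
    · intro hy m hm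
      simpa using hy (Equiv.swap j k m) ((swap_le_iff hj le_rfl).2 hm)
    · exact fun hy m hm => hy _ ((swap_le_iff hj le_rfl).2 hm)
  · exact ⟨fun hG => hG k le_rfl, fun hk m hm =>
      (hm.lt_or_eq.elim (fun hlt => (hy m hlt).le) (fun he => he ▸ le_rfl)).trans hk⟩

end ExchangeableWithoutTies

/-! ### Countable inclusion–exclusion -/

/-- Inclusion–exclusion for a countable union of events, when the sum converges absolutely. -/
theorem hasSum_inclusion_exclusion {Ω : Type*} [MeasurableSpace Ω] {P : Measure Ω}
    [IsFiniteMeasure P] {A : Set Ω} (hA : MeasurableSet A) {C : ℕ → Set Ω}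
    (hC : ∀ j, MeasurableSet (C j)) (k : ℕ)
    (hs : Summable fun K : LaterIndices k => P.real (A ∩ ⋂ j ∈ K.1, C j)) :
    HasSum (fun K : LaterIndices k => (-1 : ℝ) ^ (K.1.card - 1) * P.real (A ∩ ⋂ j ∈ K.1, C j))
      (P.real (A ∩ ⋃ j > k, C j)) := by
  have hsum : Summable fun K : LaterIndices k =>
      (-1 : ℝ) ^ (K.1.card - 1) * P.real (A ∩ ⋂ j ∈ K.1, C j) := by
    refine Summable.of_norm_bounded hs fun K => ?_
    simp [abs_of_nonneg measureReal_nonneg]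
  -- The subsets of (k, M] exhaust the index type. Along them the partial sums are finite
  -- inclusion–exclusion, and absolute convergence identifies their limit with the sum.
  let t : ℕ → Finset (LaterIndices k) := fun M =>
    (Finset.Ioc k M).powerset.subtype fun K => K.Nonempty ∧ ∀ j ∈ K, k < j
  have ht : Filter.Tendsto t Filter.atTop Filter.atTop := by
    refine Filter.tendsto_atTop_finset_of_monotone (fun M N hMN K hK => ?_) fun K => ?_
    · simp only [t, Finset.mem_subtype, Finset.mem_powerset] at hK ⊢
      exact hK.trans (Finset.Ioc_subset_Ioc_right hMN)
    · refine ⟨K.1.sup id, ?_⟩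
      simp only [t, Finset.mem_subtype, Finset.mem_powerset]
      exact fun j hj => Finset.mem_Ioc.2 ⟨K.2.2 j hj, Finset.le_sup (f := id) hj⟩
  have hfin : ∀ M, ∑ K ∈ t M, (-1 : ℝ) ^ (K.1.card - 1) * P.real (A ∩ ⋂ j ∈ K.1, C j) =
      P.real (⋃ j ∈ Finset.Ioc k M, A ∩ C j) := by
    intro M
    rw [measureReal_biUnion_eq_sum_powerset (fun j _ => hA.inter (hC j))]
    have hfilter : ((Finset.Ioc k M).powerset.filter fun K => K.Nonempty) =
        (Finset.Ioc k M).powerset.filter fun K => K.Nonempty ∧ ∀ j ∈ K, k < j := by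
      refine Finset.filter_congr fun K hK => ?_
      rw [Finset.mem_powerset] at hK
      exact (and_iff_left fun j hj => (Finset.mem_Ioc.1 (hK hj)).1).symm
    rw [hfilter]
    refine (Finset.sum_subtype_eq_sum_filter
      (fun K : Finset ℕ => (-1 : ℝ) ^ (K.card - 1) * P.real (A ∩ ⋂ j ∈ K, C j))).trans ?_
    refine Finset.sum_congr rfl fun K hK => ?_
    have hne : K.Nonempty := (Finset.mem_filter.1 hK).2.1
    obtain ⟨n, hn⟩ : ∃ n, K.card = n + 1 := ⟨K.card - 1, by have := hne.card_pos; omega⟩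
    have hset : (⋂ j ∈ K, A ∩ C j) = A ∩ ⋂ j ∈ K, C j := by
      ext ω
      obtain ⟨j, hj⟩ := hne
      simp only [Set.mem_iInter, Set.mem_inter_iff]
      exact ⟨fun h => ⟨(h j hj).1, fun i hi => (h i hi).2⟩, fun h i hi => ⟨h.1, h.2 i hi⟩⟩
    rw [hset, hn, Nat.add_sub_cancel, pow_add, pow_add]
    simp
  have hlim : Filter.Tendsto (fun M => P.real (⋃ j ∈ Finset.Ioc k M, A ∩ C j)) Filter.atTop
      (nhds (P.real (A ∩ ⋃ j > k, C j))) := by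
    have hunion : (A ∩ ⋃ j > k, C j) = ⋃ M, ⋃ j ∈ Finset.Ioc k M, A ∩ C j := by
      ext ω
      simp only [Set.mem_inter_iff, Set.mem_iUnion, Finset.mem_Ioc, exists_prop]
      exact ⟨fun ⟨hω, j, hj, hjω⟩ => ⟨j, j, ⟨hj, le_rfl⟩, hω, hjω⟩,
        fun ⟨_, j, hj, hω, hjω⟩ => ⟨hω, j, hj.1, hjω⟩⟩
    rw [hunion]
    refine (ENNReal.tendsto_toReal (measure_ne_top P _)).comp
      (tendsto_measure_iUnion_atTop fun M N hMN => ?_)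
    exact Set.biUnion_subset_biUnion_left fun j hj => Finset.Ioc_subset_Ioc_right hMN hj
  have huniq := tendsto_nhds_unique ((hsum.hasSum.comp ht).congr hfin) hlim
  exact huniq ▸ hsum.hasSum

/-! ### The terminal time -/

/-- The terminal complete record is the complete record that is followed by no other. -/
theorem terminalTime_eq_iff {d : ℕ} (y : ℕ+ → Fin d → ℝ) (n : ℕ+) :
    terminalTime y = ((n : ℕ) : ℕ∞) ↔
      IsCompleteRecord y n ∧ ∀ m > n, ¬ IsCompleteRecord y m := by
  constructor
  · intro h
    unfold terminalTime at h
    have hne : Nonempty ↑((fun m : ℕ+ => ((m : ℕ) : ℕ∞)) '' {m | IsCompleteRecord y m}) :=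
      ⟨⟨_, 1, fun m hm => absurd hm not_lt_one, rfl⟩⟩
    -- A finite supremum of a nonempty set in `ℕ∞` is attained.
    obtain ⟨m, hm, hmn⟩ := ENat.sSup_mem_of_nonempty_of_lt_top (h ▸ ENat.natCast_lt_top _)
    rw [h] at hmn
    have hmn' : m = n := by
      simpa using hmn
    refine ⟨hmn' ▸ hm, fun l hl hrec => ?_⟩
    have hle : ((l : ℕ) : ℕ∞) ≤ ((n : ℕ) : ℕ∞) := h ▸ le_sSup ⟨l, hrec, rfl⟩
    exact absurd (Nat.cast_le.1 hle) (not_le.2 hl)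
  · rintro ⟨hn, hmax⟩
    refine IsGreatest.csSup_eq ⟨⟨n, hn, rfl⟩, ?_⟩
    rintro _ ⟨m, hm, rfl⟩
    exact Nat.cast_le.2 (not_lt.1 fun hlt => hmax m hlt hm)

theorem terminalTime_lt_top {d : ℕ} {y : ℕ+ → Fin d → ℝ}
    (h : {m | IsCompleteRecord y m}.Finite) : terminalTime y < ⊤ := by
  refine (Set.Finite.csSup_lt_iff (h.image _) ?_).2 ?_
  · exact ⟨_, 1, fun m hm => absurd hm not_lt_one, rfl⟩
  · rintro _ ⟨m, -, rfl⟩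
    exact ENat.natCast_lt_top _

/-! ### Laws of the component sequences -/

/-- A sequence of independent random variables with a common continuous distribution function is
exchangeable and almost surely has no ties. -/
theorem exchangeableWithoutTies_of_iIndepFun {Ω : Type*} [MeasurableSpace Ω] {P : Measure Ω}
    [IsProbabilityMeasure P] {Y : ℕ+ → Ω → ℝ} (hY : ∀ n, Measurable (Y n)) (h : iIndepFun Y P)
    {μ : Measure ℝ} [NullSingletonClass μ] (hid : ∀ n, P.map (Y n) = μ) :
    ExchangeableWithoutTies (P.map fun ω n => Y n ω) where
  map_swap a b := map_comp_injective_of_iIndepFun hY h hid (Equiv.swap a b).injective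
  ties_null a b hab := by
    have : NullSingletonClass (P.map (Y b)) := by rw [hid b]; infer_instance
    rw [Measure.map_apply (by fun_prop)
      (measurableSet_eq_fun (measurable_pi_apply a) (measurable_pi_apply b))]
    exact measure_eq_zero_of_indepFun (hY a) (hY b) (h.indepFun hab)

theorem measureReal_forall_le_eq_pow {Ω : Type*} [MeasurableSpace Ω] {P : Measure Ω}
    [IsProbabilityMeasure P] {Y : ℕ+ → Ω → ℝ} (hY : ∀ n, Measurable (Y n)) (h : iIndepFun Y P)
    {μ : Measure ℝ} [IsProbabilityMeasure μ] (hid : ∀ n, P.map (Y n) = μ) (x : ℝ) (k : ℕ+) :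
    (P.map fun ω n => Y n ω).real {y | ∀ m ≤ k, y m ≤ x} = cdf μ x ^ (k : ℕ) := by
  have hset : {y : ℕ+ → ℝ | ∀ m ≤ k, y m ≤ x} =
      ⋂ m ∈ Finset.Icc 1 k, (fun y : ℕ+ → ℝ => y m) ⁻¹' Set.Iic x := by
    ext y; simp
  have hmeas : MeasurableSet {y : ℕ+ → ℝ | ∀ m ≤ k, y m ≤ x} := by
    rw [hset]
    exact Finset.measurableSet_biInter _ fun m _ => measurable_pi_apply m measurableSet_Iic
  rw [map_measureReal_apply (by fun_prop) hmeas, hset, Set.preimage_iInter₂]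
  have := h.measure_inter_preimage_eq_mul (S := Finset.Icc 1 k) (sets := fun _ => Set.Iic x)
    (fun _ _ => measurableSet_Iic)
  have hone : ∀ m, P (Y m ⁻¹' Set.Iic x) = μ (Set.Iic x) := fun m => by
    rw [← hid m, Measure.map_apply (hY m) measurableSet_Iic]
  simp only [hone, Finset.prod_const, PNat.card_Icc] at this
  rw [cdf_eq_real, measureReal_def, measureReal_def, ← ENNReal.toReal_pow]
  simpa [Set.preimage_preimage] using congrArg ENNReal.toReal this

/-! ### Complete records of random vectors -/

section CompleteRecords

variable {Ω : Type*} {d : ℕ}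

/-- The event that the vector with index `j` is a complete record. -/
def completeRecordEvent (X : ℕ+ → Ω → Fin d → ℝ) (j : ℕ) : Set Ω :=
  {ω | ∀ n : ℕ+, (n : ℕ) = j → IsCompleteRecord (fun m => X m ω) n}

theorem isCompleteRecord_iff {y : ℕ+ → Fin d → ℝ} {n : ℕ+} :
    IsCompleteRecord y n ↔ ∀ i, IsStrictRecord (fun m => y m i) n :=
  ⟨fun h i m hm => h m hm i, fun h m hm i => h i m hm⟩

theorem mem_completeRecordEvent {X : ℕ+ → Ω → Fin d → ℝ} {n : ℕ+} {ω : Ω} :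
    ω ∈ completeRecordEvent X n ↔ IsCompleteRecord (fun m => X m ω) n :=
  ⟨fun h => h n rfl, fun h _ hm => PNat.coe_injective hm ▸ h⟩

theorem completeRecordEvent_inter_eq_iInter (X : ℕ+ → Ω → Fin d → ℝ) (k : ℕ+) (S : Finset ℕ)
    (B : Fin d → Set ℝ) :
    ((completeRecordEvent X k ∩ {ω | ∀ i, X k ω i ∈ B i}) ∩ ⋂ j ∈ S, completeRecordEvent X j) =
      ⋂ i ∈ Finset.univ, (fun ω n => X n ω i) ⁻¹' recordEvent k S (B i) := by
  ext ω
  simp only [Set.mem_inter_iff, mem_completeRecordEvent, Set.mem_ofPred_eq, Set.mem_iInter,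
    Finset.mem_univ, true_imp_iff, Set.mem_preimage, recordEvent]
  constructor
  · rintro ⟨⟨hk, hB⟩, hS⟩ i
    exact ⟨isCompleteRecord_iff.1 hk i, hB i, fun n hn => isCompleteRecord_iff.1 (hS n hn n rfl) i⟩
  · intro h
    exact ⟨⟨isCompleteRecord_iff.2 fun i => (h i).1, fun i => (h i).2.1⟩, fun j hj n hn =>
      isCompleteRecord_iff.2 fun i => (h i).2.2 n (hn ▸ hj)⟩

variable [MeasurableSpace Ω] {P : Measure Ω}

theorem measurableSet_completeRecordEvent {X : ℕ+ → Ω → Fin d → ℝ} (hX : ∀ n, Measurable (X n))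
    (j : ℕ) : MeasurableSet (completeRecordEvent X j) := by
  have : completeRecordEvent X j = ⋂ (n : ℕ+) (_ : (n : ℕ) = j) (m : ℕ+) (_ : m < n) (i : Fin d),
      {ω | X m ω i < X n ω i} := by
    ext ω; simp [completeRecordEvent, IsCompleteRecord]
  rw [this]
  exact .iInter fun n => .iInter fun _ => .iInter fun m => .iInter fun _ => .iInter fun i =>
    measurableSet_lt (by fun_prop) (by fun_prop)

theorem measurableSet_forall_mem {X : ℕ+ → Ω → Fin d → ℝ} (hX : ∀ n, Measurable (X n)) (k : ℕ+)
    {B : Fin d → Set ℝ} (hB : ∀ i, MeasurableSet (B i)) :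
    MeasurableSet {ω | ∀ i, X k ω i ∈ B i} := by
  have : {ω | ∀ i, X k ω i ∈ B i} = ⋂ i, (fun ω => X k ω i) ⁻¹' B i := by ext; simp
  rw [this]
  exact .iInter fun i => (by fun_prop : Measurable fun ω => X k ω i) (hB i)

theorem measureReal_completeRecordEvent_inter {X : ℕ+ → Ω → Fin d → ℝ}
    (hX : ∀ n, Measurable (X n)) (h : iIndepFun (fun i ω n => X n ω i) P) (k : ℕ+) (S : Finset ℕ)
    {B : Fin d → Set ℝ} (hB : ∀ i, MeasurableSet (B i)) :
    P.real ((completeRecordEvent X k ∩ {ω | ∀ i, X k ω i ∈ B i}) ∩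
      ⋂ j ∈ S, completeRecordEvent X j) =
      ∏ i, (P.map fun ω n => X n ω i).real (recordEvent k S (B i)) := by
  have hmeas := fun i => measurableSet_recordEvent k S (hB i)
  rw [completeRecordEvent_inter_eq_iInter, measureReal_def,
    h.measure_inter_preimage_eq_mul (S := Finset.univ) (fun i _ => hmeas i), ENNReal.toReal_prod]
  refine Finset.prod_congr rfl fun i _ => ?_
  rw [map_measureReal_apply (by fun_prop) (hmeas i), measureReal_def]

variable [IsProbabilityMeasure P]

theorem measureReal_completeRecordEvent_inter_univ {X : ℕ+ → Ω → Fin d → ℝ}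
    (hX : ∀ n, Measurable (X n)) (h : iIndepFun (fun i ω n => X n ω i) P)
    (hexch : ∀ i, ExchangeableWithoutTies (P.map fun ω n => X n ω i)) (k : ℕ+) (S : Finset ℕ)
    (hS : ∀ s ∈ S, (k : ℕ) < s) :
    P.real (completeRecordEvent X k ∩ ⋂ j ∈ S, completeRecordEvent X j) =
      ∏ s ∈ insert (k : ℕ) S, ((s : ℝ) ^ d)⁻¹ := by
  have hprob : ∀ i, IsProbabilityMeasure (P.map fun ω n => X n ω i) := fun i =>
    Measure.isProbabilityMeasure_map (by fun_prop)
  have := measureReal_completeRecordEvent_inter hX h k S (B := fun _ => Set.univ) fun _ => .univ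
  simp only [Set.mem_univ, implies_true, Set.ofPred_true, Set.inter_univ] at this
  rw [this, Finset.prod_congr rfl fun i _ => (hexch i).measureReal_recordEvent_univ k S hS]
  simp [Finset.prod_pow]

/-- Dropping A bounds each term by the product of s^(-d) over K'; such products are summable over
finite sets because ∑ s^(-d) converges. -/
theorem summable_measureReal_completeRecordEvent_inter {X : ℕ+ → Ω → Fin d → ℝ} (hd : 2 ≤ d)
    (hX : ∀ n, Measurable (X n)) (h : iIndepFun (fun i ω n => X n ω i) P)
    (hexch : ∀ i, ExchangeableWithoutTies (P.map fun ω n => X n ω i)) (k : ℕ+) (A : Set Ω) :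
    Summable fun K : LaterIndices k =>
      P.real ((completeRecordEvent X k ∩ A) ∩ ⋂ j ∈ K.1, completeRecordEvent X j) := by
  have hsum : Summable fun K : LaterIndices k => ∏ s ∈ K.1, ((s : ℝ) ^ d)⁻¹ :=
    (summable_finsetProd_of_summable_nonneg (fun s : ℕ => by positivity)
      (Real.summable_nat_pow_inv.2 (by omega))).comp_injective Subtype.val_injective
  refine Summable.of_nonneg_of_le (fun _ => measureReal_nonneg) (fun K => ?_)
    (hsum.mul_left (((k : ℕ) : ℝ) ^ d)⁻¹)
  rw [← Finset.prod_insert (s := K.1) (a := (k : ℕ)) (f := fun s : ℕ => ((s : ℝ) ^ d)⁻¹)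
      fun hk => (K.2.2 _ hk).ne rfl,
    ← measureReal_completeRecordEvent_inter_univ hX h hexch k K.1 K.2.2]
  exact measureReal_mono (Set.inter_subset_inter_left _ Set.inter_subset_left)

/-- Borel–Cantelli: a complete record at k has probability k^(-d), which is summable. -/
theorem ae_terminalTime_lt_top {X : ℕ+ → Ω → Fin d → ℝ} (hd : 2 ≤ d)
    (hX : ∀ n, Measurable (X n)) (h : iIndepFun (fun i ω n => X n ω i) P)
    (hexch : ∀ i, ExchangeableWithoutTies (P.map fun ω n => X n ω i)) :
    ∀ᵐ ω ∂P, terminalTime (fun m => X m ω) < ⊤ := by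
  have hsum : Summable fun k : ℕ+ => (((k : ℕ) : ℝ) ^ d)⁻¹ :=
    (Real.summable_nat_pow_inv.2 (by omega)).comp_injective PNat.coe_injective
  have hprob : ∀ k : ℕ+, P (completeRecordEvent X k) =
      ENNReal.ofReal (((k : ℕ) : ℝ) ^ d)⁻¹ := fun k => by
    have := measureReal_completeRecordEvent_inter_univ hX h hexch k ∅ (by simp)
    simp only [Finset.notMem_empty, Set.iInter_of_empty, Set.iInter_univ, Set.inter_univ,
      insert_empty_eq, Finset.prod_singleton] at this
    rw [← this, ofReal_measureReal]
  have hfin : ∑' k : ℕ+, P (completeRecordEvent X k) ≠ ⊤ := by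
    simp only [hprob]
    exact hsum.tsum_ofReal_ne_top
  filter_upwards [ae_finite_setOfPred_mem hfin] with ω hω
  simp only [mem_completeRecordEvent] at hω
  exact terminalTime_lt_top hω

theorem hasSum_measureReal_terminalRecordLE {X : ℕ+ → Ω → Fin d → ℝ}
    (hX : ∀ n, Measurable (X n)) (x : Fin d → ℝ) :
    HasSum (fun k : ℕ+ =>
      P.real (completeRecordEvent X k ∩ {ω | ∀ i, X k ω i ∈ Set.Iic (x i)}) -
        P.real ((completeRecordEvent X k ∩ {ω | ∀ i, X k ω i ∈ Set.Iic (x i)}) ∩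
          ⋃ j > (k : ℕ), completeRecordEvent X j))
      (P.real (terminalRecordLE X x)) := by
  set A : ℕ+ → Set Ω := fun k =>
    completeRecordEvent X k ∩ {ω | ∀ i, X k ω i ∈ Set.Iic (x i)} with hA
  set U : ℕ+ → Set Ω := fun k => ⋃ j > (k : ℕ), completeRecordEvent X j with hU
  have hUmeas : ∀ k, MeasurableSet (U k) := fun k =>
    .iUnion fun j => .iUnion fun _ => measurableSet_completeRecordEvent hX j
  have hAmeas : ∀ k, MeasurableSet (A k) := fun k =>
    (measurableSet_completeRecordEvent hX k).inter
      (measurableSet_forall_mem hX k fun _ => measurableSet_Iic)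
  have hmem : ∀ k ω, ω ∈ A k \ U k ↔
      terminalTime (fun m => X m ω) = ((k : ℕ) : ℕ∞) ∧ ∀ i, X k ω i ≤ x i := by
    intro k ω
    have hUk : ω ∈ U k ↔ ∃ m > k, IsCompleteRecord (fun m => X m ω) m := by
      simp only [hU, Set.mem_iUnion, exists_prop]
      constructor
      -- The event at index 0 is vacuously everything; j > k keeps it out of the union.
      · rintro ⟨j, hj, hω⟩
        exact ⟨⟨j, (Nat.zero_le _).trans_lt hj⟩, hj, hω _ rfl⟩
      · rintro ⟨m, hm, hω⟩
        exact ⟨m, hm, mem_completeRecordEvent.2 hω⟩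
    rw [Set.mem_sdiff, hUk, terminalTime_eq_iff]
    simp only [hA, Set.mem_inter_iff, mem_completeRecordEvent, Set.mem_ofPred_eq, Set.mem_Iic]
    push Not
    tauto
  have hunion : terminalRecordLE X x = ⋃ k, A k \ U k := by
    ext ω
    rw [Set.mem_iUnion]
    exact exists_congr fun k => (hmem k ω).symm
  have hdisj : Pairwise (Function.onFun Disjoint fun k => A k \ U k) := by
    intro k l hkl
    refine Set.disjoint_left.2 fun ω hk hl => hkl ?_
    have := ((hmem k ω).1 hk).1.symm.trans ((hmem l ω).1 hl).1
    simpa using this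
  have hmeas : ∀ k, MeasurableSet (A k \ U k) := fun k => (hAmeas k).diff (hUmeas k)
  have hdiff : ∀ k, P.real (A k) - P.real (A k ∩ U k) = P.real (A k \ U k) := fun k => by
    rw [← measureReal_inter_add_sdiff (μ := P) (s := A k) (hUmeas k)]
    ring
  change HasSum (fun k => P.real (A k) - P.real (A k ∩ U k)) _
  simp only [hdiff]
  have htsum := measure_iUnion (μ := P) hdisj hmeas
  rw [hunion, measureReal_def, htsum, ENNReal.tsum_toReal_eq fun _ => measure_ne_top P _]
  exact ENNReal.hasSum_toReal (htsum ▸ measure_ne_top P _)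

end CompleteRecords

/-! ### Assembly of the formula -/

theorem recordFactor_singleton (k : ℕ) (u : ℝ) : recordFactor {k} u = u ^ k / k := by
  simp [recordFactor]

theorem theorem1 {Ω : Type*} [MeasurableSpace Ω] (P : Measure Ω) [IsProbabilityMeasure P]
    (d : ℕ) (hd : 2 ≤ d)
    (X : ℕ+ → Ω → Fin d → ℝ)
    (hmeas : ∀ n, Measurable (X n))
    (hindep : iIndepFun X P)
    (hident : ∀ n, IdentDistrib (X n) (X 1) P P)
    (hcomp : iIndepFun (fun (i : Fin d) (ω : Ω) => X 1 ω i) P)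
    (F : Fin d → ℝ → ℝ)
    (hF : ∀ i, F i = cdf (P.map (fun ω => X 1 ω i)))
    (hcont : ∀ i, Continuous (F i)) :
    (∀ᵐ ω ∂P, terminalTime (fun m => X m ω) < ⊤) ∧
    ∀ (x u : Fin d → ℝ), (∀ i, u i = F i (x i)) →
      (∀ k : ℕ+, Summable (fun K : LaterIndices k => inclExclTerm u k K)) ∧
      HasSum
        (fun k : ℕ+ =>
          (∏ i, u i ^ (k : ℕ)) / ((k : ℕ) : ℝ) ^ d
            - ∑' K : LaterIndices k, inclExclTerm u k K)
        (P.real (terminalRecordLE X x)) := by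
  have hid : ∀ i n, P.map (fun ω => X n ω i) = P.map (fun ω => X 1 ω i) := fun i n =>
    ((hident n).comp (measurable_pi_apply i)).map_eq
  have hcomp' : ∀ n, iIndepFun (fun i ω => X n ω i) P := fun n => by
    rw [iIndepFun_iff_map_fun_eq_infinitePi_map (by fun_prop)] at hcomp ⊢
    simp only [hid]
    exact (hident n).map_eq.trans hcomp
  obtain ⟨hrows, hcols⟩ := iIndepFun_components hmeas hindep hcomp'
  have hprob : ∀ i, IsProbabilityMeasure (P.map (fun ω => X 1 ω i)) := fun i =>
    Measure.isProbabilityMeasure_map (by fun_prop)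
  have hprob' : ∀ i, IsProbabilityMeasure (P.map fun ω n => X n ω i) := fun i =>
    Measure.isProbabilityMeasure_map (by fun_prop)
  have hatom : ∀ i, NullSingletonClass (P.map (fun ω => X 1 ω i)) := fun i =>
    nullSingletonClass_of_continuous_cdf (hF i ▸ hcont i)
  have hexch : ∀ i, ExchangeableWithoutTies (P.map fun ω n => X n ω i) := fun i =>
    exchangeableWithoutTies_of_iIndepFun (fun n => by fun_prop) (hcols i) (hid i)
  refine ⟨ae_terminalTime_lt_top hd hmeas hrows hexch, fun x u hu => ?_⟩
  have hpow : ∀ i (k : ℕ+), (P.map fun ω n => X n ω i).real {y | ∀ m ≤ k, y m ≤ x i} =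
      u i ^ (k : ℕ) := fun i k => by
    rw [measureReal_forall_le_eq_pow (fun n => by fun_prop) (hcols i) (hid i), hu i, hF i]
  have hfactor : ∀ (k : ℕ+) (S : Finset ℕ), (∀ s ∈ S, (k : ℕ) < s) →
      P.real ((completeRecordEvent X k ∩ {ω | ∀ i, X k ω i ∈ Set.Iic (x i)}) ∩
        ⋂ j ∈ S, completeRecordEvent X j) = ∏ i, recordFactor (insert (k : ℕ) S) (u i) := by
    intro k S hS
    rw [measureReal_completeRecordEvent_inter hmeas hrows k S fun _ => measurableSet_Iic]
    exact Finset.prod_congr rfl fun i _ => (hexch i).measureReal_recordEvent_Iic (hpow i) k S hS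
  have hsum : ∀ k : ℕ+, HasSum (fun K : LaterIndices k => inclExclTerm u k K)
      (P.real ((completeRecordEvent X k ∩ {ω | ∀ i, X k ω i ∈ Set.Iic (x i)}) ∩
        ⋃ j > (k : ℕ), completeRecordEvent X j)) := by
    intro k
    have hmeasA : MeasurableSet
        (completeRecordEvent X k ∩ {ω | ∀ i, X k ω i ∈ Set.Iic (x i)}) :=
      (measurableSet_completeRecordEvent hmeas k).inter
        (measurableSet_forall_mem hmeas k fun _ => measurableSet_Iic)
    convert hasSum_inclusion_exclusion hmeasA (measurableSet_completeRecordEvent hmeas) (k : ℕ)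
      (summable_measureReal_completeRecordEvent_inter hd hmeas hrows hexch k _) using 2 with K
    rw [hfactor k K.1 K.2.2, inclExclTerm]
  refine ⟨fun k => (hsum k).summable, ?_⟩
  convert hasSum_measureReal_terminalRecordLE (P := P) hmeas x using 2 with k
  rw [(hsum k).tsum_eq]
  congr 1
  -- The leading term is the case K' = {k}, where each factor is u^k / k.
  have := hfactor k ∅ (by simp)
  simp only [Finset.notMem_empty, Set.iInter_of_empty, Set.iInter_univ, Set.inter_univ,
    insert_empty_eq, recordFactor_singleton] at this
  rw [this, Finset.prod_div_distrib]
  simp
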